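/- Let $n\ge 2$ be an integer and $k\ge 1$ a real number. Let $P(z)=\sum_{j=0}^n a_jz^j$ be a polynomial with complex coefficients of degree exactly $n$, all of whose zeros lie in $|z|\le k$. Then $$\max_{|z|=1}|P'(z)|\ \ge\ \frac{1}{1+k^n}\left(n+\frac{k^n|a_n|-|a_0|}{k^n|a_n|+|a_0|}\right)\max_{|z|=1}|P(z)|+|a_1|\,\psi(k)+\frac{k^n-1}{2k^n(1+k^n)}\left(n+\frac{k^n|a_n|-|a_0|}{k^n|a_n|+|a_0|}\right)\min_{|z|=k}|P(z)|,$$ where $\psi(k)=1-1/k^2$ if $n>2$ and $\psi(k)=1-1/k$ if $n=2$. The result is sharp: for all $n\ge 2$ and $k\ge 1$ the polynomial $P(z)=z^n+k^n$ satisfies the hypotheses, and equality holds for it. -/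

import Mathlib

open Polynomial

/-- The maximum of `|P(z)|` on the circle `|z| = r` (used only for `r > 0`). -/
noncomputable def maxModulus (P : ℂ[X]) (r : ℝ) : ℝ :=
  sSup ((fun z : ℂ => ‖P.eval z‖) '' Metric.sphere 0 r)

/-- The minimum of `|P(z)|` on the circle `|z| = r` (used only for `r > 0`). -/
noncomputable def minModulus (P : ℂ[X]) (r : ℝ) : ℝ :=
  sInf ((fun z : ℂ => ‖P.eval z‖) '' Metric.sphere 0 r)

/-- The supremum in `maxModulus` is an attained maximum. -/
theorem isGreatest_maxModulus (P : ℂ[X]) {r : ℝ} (hr : 0 ≤ r) :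
    IsGreatest ((fun z : ℂ => ‖P.eval z‖) '' Metric.sphere 0 r) (maxModulus P r) :=
  ((isCompact_sphere (0 : ℂ) r).image (by fun_prop)).isGreatest_sSup
    ((NormedSpace.sphere_nonempty.2 hr).image _)

/-- The infimum in `minModulus` is an attained minimum. -/
theorem isLeast_minModulus (P : ℂ[X]) {r : ℝ} (hr : 0 ≤ r) :
    IsLeast ((fun z : ℂ => ‖P.eval z‖) '' Metric.sphere 0 r) (minModulus P r) :=
  ((isCompact_sphere (0 : ℂ) r).image (by fun_prop)).isLeast_sInf
    ((NormedSpace.sphere_nonempty.2 hr).image _)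

/-- `ψ(k)`, equal to `1 - 1/k²` for degree `n > 2` and to `1 - 1/k` for degree `n = 2`. -/
noncomputable def psi (n : ℕ) (k : ℝ) : ℝ :=
  if 2 < n then 1 - 1 / k ^ 2 else 1 - 1 / k

/-- The factor `n + (kⁿ|aₙ| - |a₀|) / (kⁿ|aₙ| + |a₀|)`, where `aⱼ` are the coefficients of `P`. -/
noncomputable def coeffFactor (n : ℕ) (k : ℝ) (P : ℂ[X]) : ℝ :=
  n + (k ^ n * ‖P.coeff n‖ - ‖P.coeff 0‖) / (k ^ n * ‖P.coeff n‖ + ‖P.coeff 0‖)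

/-- The lower bound for the maximum of `|P'|` on the unit circle. -/
noncomputable def derivLowerBound (n : ℕ) (k : ℝ) (P : ℂ[X]) : ℝ :=
  1 / (1 + k ^ n) * coeffFactor n k P * maxModulus P 1
    + ‖P.coeff 1‖ * psi n k
    + (k ^ n - 1) / (2 * k ^ n * (1 + k ^ n)) * coeffFactor n k P * minModulus P k

/-! Let `F` be `coeffFactor`, `M_k` and `m_k` the maximum and minimum of `|P|` on `|z| = k`, and `z`
a point of that circle where `|P|` is maximal. Three estimates combine. (A) `F * M_k ≤ 2k|P'(z)|`:
the real part of `zP'/P = ∑ z/(z - w)`, over the roots `w`, is bounded below term by term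
(`coeffFactor_mul_norm_eval_le`). (B) `2kⁿ max_{|z|=1}|P| + (kⁿ - 1) m_k ≤ (kⁿ + 1) M_k`: the values
of `P(kz)` at `u` and at the reflected point `1/ū` are compared (`two_mul_pow_mul_maxModulus_le`).
(C) `k|P'(z)| ≤ kⁿ (max_{|z|=1}|P'| - ψ(k)|a₁|)`: a Bernstein-type growth bound, sharpened by the
constant coefficient of `P'` (`mul_norm_eval_derivative_le`). The sharpening comes from
interpolation at the points of the unit circle where a Blaschke product takes a prescribed
unimodular value. Multiplying (B) by `F ≥ 0`, then eliminating `M_k` by (A) and `|P'(z)|` by (C),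
gives the theorem. -/

open ComplexConjugate in
theorem norm_one_sub_conj_mul_sq_sub (u w : ℂ) :
    ‖1 - conj u * w‖ ^ 2 - ‖u - w‖ ^ 2 = (1 - ‖u‖ ^ 2) * (1 - ‖w‖ ^ 2) := by
  simp only [← Complex.normSq_eq_norm_sq, Complex.normSq_apply]
  simp
  ring

/-! ### Logarithmic derivative on the circle `|z| = k`. -/

/-- Subadditivity of `r ↦ (k - r) / (k + r)` under normalized products. -/
theorem pow_sub_prod_div_le_sum {k : ℝ} (hk : 0 < k) (s : Multiset ℝ)
    (hs : ∀ r ∈ s, 0 ≤ r ∧ r ≤ k) :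
    (k ^ s.card - s.prod) / (k ^ s.card + s.prod) ≤ (s.map fun r => (k - r) / (k + r)).sum ∧
      0 ≤ s.prod ∧ s.prod ≤ k ^ s.card := by
  induction s using Multiset.induction_on with
  | empty => simp
  | cons a s ih =>
    obtain ⟨h1, h2, h3⟩ := ih fun r hr => hs r (Multiset.mem_cons_of_mem hr)
    obtain ⟨ha, hak⟩ := hs a (Multiset.mem_cons_self a s)
    simp only [Multiset.card_cons, Multiset.prod_cons, Multiset.map_cons, Multiset.sum_cons]
    set K := k ^ s.card
    set p := s.prod
    have hK : 0 < K := pow_pos hk _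
    rw [pow_succ']
    refine ⟨?_, mul_nonneg ha h2, mul_le_mul hak h3 h2 hk.le⟩
    -- Substituting `a = k e^{-2t}` and `p = K e^{-2t'}` turns this into `tanh (t + t') ≤ tanh t +
    -- tanh t'`.
    have key : (k * K - a * p) / (k * K + a * p) ≤ (k - a) / (k + a) + (K - p) / (K + p) := by
      have e1 : 0 < k * K + a * p := by positivity
      have e2 : 0 < k + a := by positivity
      have e3 : 0 < K + p := by positivity
      have : (k - a) / (k + a) + (K - p) / (K + p) - (k * K - a * p) / (k * K + a * p) =
          (k * K - a * p) * (k - a) * (K - p) / ((k + a) * (K + p) * (k * K + a * p)) := by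
        field_simp
        ring
      have h : 0 ≤ k * K - a * p := sub_nonneg.2 (mul_le_mul hak h3 h2 hk.le)
      have := div_nonneg (mul_nonneg (mul_nonneg h (sub_nonneg.2 hak)) (sub_nonneg.2 h3))
        (mul_pos (mul_pos e2 e3) e1).le
      linarith
    linarith

theorem half_add_le_re_div_sub {k : ℝ} {z w : ℂ} (hk : 0 < k) (hz : ‖z‖ = k) (hw : ‖w‖ ≤ k)
    (hzw : z ≠ w) : 1 / 2 * (1 + (k - ‖w‖) / (k + ‖w‖)) ≤ (z * (1 / (z - w))).re := by
  have hpos : 0 < ‖z - w‖ := norm_pos_iff.2 (sub_ne_zero.2 hzw)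
  have hkw : 0 < k + ‖w‖ := by positivity
  -- The Poisson kernel appears; it is smallest when `w` is opposite to `z`, where `|z - w| = k +
  -- |w|`.
  have e1 : (z * (1 / (z - w))).re = 1 / 2 * (1 + (k ^ 2 - ‖w‖ ^ 2) / ‖z - w‖ ^ 2) := by
    have hn : z.re * z.re + z.im * z.im = k ^ 2 := by
      rw [← hz, ← Complex.normSq_eq_norm_sq, Complex.normSq_apply]
    have hne : Complex.normSq (z - w) ≠ 0 := by
      rw [Complex.normSq_eq_norm_sq]; positivity
    rw [← Complex.normSq_eq_norm_sq (z - w), ← Complex.normSq_eq_norm_sq w, ← hn]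
    rw [one_div, Complex.mul_re, Complex.inv_re, Complex.inv_im]
    field_simp
    simp only [Complex.normSq_apply, Complex.sub_re, Complex.sub_im]
    ring
  have e2 : ‖z - w‖ ≤ k + ‖w‖ := by rw [← hz]; exact norm_sub_le z w
  have e3 : (k - ‖w‖) / (k + ‖w‖) ≤ (k ^ 2 - ‖w‖ ^ 2) / ‖z - w‖ ^ 2 := by
    have : (k - ‖w‖) / (k + ‖w‖) = (k ^ 2 - ‖w‖ ^ 2) / (k + ‖w‖) ^ 2 := by
      field_simp
      ring
    rw [this]
    have : 0 ≤ k ^ 2 - ‖w‖ ^ 2 := by nlinarith [norm_nonneg w]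
    gcongr
  rw [e1]
  linarith

theorem coeffFactor_mul_norm_eval_le {n : ℕ} {k : ℝ} (hk : 0 < k) {P : ℂ[X]}
    (hn : P.natDegree = n) (hP : ∀ z : ℂ, P.eval z = 0 → ‖z‖ ≤ k) {z : ℂ} (hz : ‖z‖ = k)
    (hPz : P.eval z ≠ 0) :
    coeffFactor n k P * ‖P.eval z‖ ≤ 2 * (k * ‖(derivative P).eval z‖) := by
  have hsp : P.Splits := IsAlgClosed.splits P
  have hP0 : P ≠ 0 := by rintro rfl; simp at hPz
  have hcard : P.roots.card = n := by rw [← hsp.natDegree_eq_card_roots, hn]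
  have hroot : ∀ w ∈ P.roots, ‖w‖ ≤ k ∧ z ≠ w := fun w hw => by
    have : P.eval w = 0 := (mem_roots hP0).1 hw
    exact ⟨hP w this, by rintro rfl; exact hPz this⟩
  have hlog := hsp.eval_derivative_div_eval_of_ne_zero hPz
  have h1 : (P.roots.map fun w => 1 / 2 * (1 + (k - ‖w‖) / (k + ‖w‖))).sum ≤
      (P.roots.map fun w => (z * (1 / (z - w))).re).sum :=
    Multiset.sum_map_le_sum_map _ _ fun w hw =>
      half_add_le_re_div_sub hk hz (hroot w hw).1 (hroot w hw).2
  have h2 : (P.roots.map fun w => (z * (1 / (z - w))).re).sum =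
      (z * ((derivative P).eval z / P.eval z)).re := by
    rw [hlog, ← Multiset.sum_map_mul_left]
    have := map_multiset_sum Complex.reAddGroupHom (P.roots.map fun w => z * (1 / (z - w)))
    rw [Multiset.map_map] at this
    exact this.symm
  have h3 : (z * ((derivative P).eval z / P.eval z)).re ≤
      k * (‖(derivative P).eval z‖ / ‖P.eval z‖) := by
    refine (Complex.re_le_norm _).trans ?_
    rw [norm_mul, norm_div, hz]
  have h4 := (pow_sub_prod_div_le_sum hk (P.roots.map fun w => ‖w‖) (by
    intro r hr
    obtain ⟨w, hw, rfl⟩ := Multiset.mem_map.1 hr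
    exact ⟨norm_nonneg w, (hroot w hw).1⟩)).1
  rw [Multiset.card_map, hcard, Multiset.map_map] at h4
  -- Vieta: the product of the root moduli is `|a₀|/|aₙ|`, which turns the subadditivity bound into
  -- the quotient in `coeffFactor`.
  have h5 : ‖P.coeff 0‖ = ‖P.coeff n‖ * (P.roots.map fun w => ‖w‖).prod := by
    rw [hsp.coeff_zero_eq_leadingCoeff_mul_prod_roots, norm_mul, norm_mul, norm_pow, norm_neg,
      norm_one, one_pow, one_mul, leadingCoeff, hn]
    congr 1
    exact map_multiset_prod (normHom : ℂ →*₀ ℝ) P.roots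
  have hc : 0 < ‖P.coeff n‖ := by
    rw [norm_pos_iff, ← hn]
    exact leadingCoeff_ne_zero.2 hP0
  have h6 : (k ^ n * ‖P.coeff n‖ - ‖P.coeff 0‖) / (k ^ n * ‖P.coeff n‖ + ‖P.coeff 0‖) =
      (k ^ n - (P.roots.map fun w => ‖w‖).prod) / (k ^ n + (P.roots.map fun w => ‖w‖).prod) := by
    rw [h5, mul_comm (k ^ n), ← mul_sub, ← mul_add, mul_div_mul_left _ _ hc.ne']
  have h7 : (P.roots.map fun w => 1 / 2 * (1 + (k - ‖w‖) / (k + ‖w‖))).sum =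
      1 / 2 * (n + (P.roots.map fun w => (k - ‖w‖) / (k + ‖w‖)).sum) := by
    rw [Multiset.sum_map_mul_left, Multiset.sum_map_add]
    simp [hcard]
  have h8 : coeffFactor n k P ≤ 2 * (k * (‖(derivative P).eval z‖ / ‖P.eval z‖)) := by
    rw [coeffFactor, h6]
    simp only [Function.comp_def] at h4
    linarith
  have hpos : 0 < ‖P.eval z‖ := norm_pos_iff.2 hPz
  calc _ ≤ 2 * (k * (‖(derivative P).eval z‖ / ‖P.eval z‖)) * ‖P.eval z‖ := by gcongr
    _ = _ := by field_simp

/-! ### Comparison of values at `u` and at its reflection `1/ū` in the unit circle. -/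

section Reflection
open ComplexConjugate

theorem norm_eval_eq_leadingCoeff_mul_prod (f : ℂ[X]) (u : ℂ) :
    ‖f.eval u‖ = ‖f.leadingCoeff‖ * (f.roots.map fun w => ‖u - w‖).prod := by
  rw [(IsAlgClosed.splits f).eval_eq_prod_roots, norm_mul]
  congr 1
  have := map_multiset_prod (normHom : ℂ →*₀ ℝ) (f.roots.map (u - ·))
  rw [Multiset.map_map] at this
  exact this

theorem norm_pow_mul_norm_eval_conj_inv {f : ℂ[X]} {u : ℂ} (hu : u ≠ 0) :
    ‖u‖ ^ f.natDegree * ‖f.eval (conj u)⁻¹‖ =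
      ‖f.leadingCoeff‖ * (f.roots.map fun w => ‖1 - conj u * w‖).prod := by
  have hu' : conj u ≠ 0 := by simpa using hu
  have h : ∀ w : ℂ, ‖1 - conj u * w‖ = ‖u‖ * ‖(conj u)⁻¹ - w‖ := fun w => by
    rw [← Complex.norm_conj u, ← norm_mul, mul_sub, mul_inv_cancel₀ hu']
  simp only [h, Multiset.prod_map_mul, Multiset.map_const', Multiset.prod_replicate]
  rw [norm_eval_eq_leadingCoeff_mul_prod, ← (IsAlgClosed.splits f).natDegree_eq_card_roots]
  ring

/-- Factor by factor, `|u - w| ≤ |1 - ūw|` when `u` and `w` both lie in the closed unit disc. -/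
theorem norm_eval_le_of_roots_le_one {f : ℂ[X]} (hf : ∀ w, f.eval w = 0 → ‖w‖ ≤ 1) {u : ℂ}
    (hu : u ≠ 0) (hu1 : ‖u‖ ≤ 1) : ‖f.eval u‖ ≤ ‖u‖ ^ f.natDegree * ‖f.eval (conj u)⁻¹‖ := by
  rcases eq_or_ne f 0 with rfl | hf0
  · simp
  rw [norm_pow_mul_norm_eval_conj_inv hu, norm_eval_eq_leadingCoeff_mul_prod]
  gcongr
  refine Multiset.prod_map_le_prod_map₀ _ _ (fun _ _ => norm_nonneg _) fun w hw => ?_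
  have hw1 := hf w ((mem_roots hf0).1 hw)
  have := norm_one_sub_conj_mul_sq_sub u w
  have := mul_nonneg (sub_nonneg.2 (pow_le_one₀ (n := 2) (norm_nonneg u) hu1))
    (sub_nonneg.2 (pow_le_one₀ (n := 2) (norm_nonneg w) hw1))
  exact le_of_sq_le_sq (by linarith) (norm_nonneg _)

theorem norm_pow_mul_norm_eval_conj_inv_le_of_one_le_roots {f : ℂ[X]} {n : ℕ}
    (hn : f.natDegree ≤ n) (hf : ∀ w, f.eval w = 0 → 1 ≤ ‖w‖) {u : ℂ}
    (hu : u ≠ 0) (hu1 : ‖u‖ ≤ 1) : ‖u‖ ^ n * ‖f.eval (conj u)⁻¹‖ ≤ ‖f.eval u‖ := by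
  rcases eq_or_ne f 0 with rfl | hf0
  · simp
  refine (mul_le_mul_of_nonneg_right (pow_le_pow_of_le_one (norm_nonneg u) hu1 hn)
    (norm_nonneg _)).trans ?_
  rw [norm_pow_mul_norm_eval_conj_inv hu, norm_eval_eq_leadingCoeff_mul_prod]
  gcongr
  refine Multiset.prod_map_le_prod_map₀ _ _ (fun _ _ => norm_nonneg _) fun w hw => ?_
  have hw1 := hf w ((mem_roots hf0).1 hw)
  have := norm_one_sub_conj_mul_sq_sub u w
  have := mul_nonneg (sub_nonneg.2 (pow_le_one₀ (n := 2) (norm_nonneg u) hu1))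
    (sub_nonneg.2 (one_le_pow₀ (n := 2) hw1))
  exact le_of_sq_le_sq (by linarith) (norm_nonneg _)

theorem norm_eval_le_of_norm_le_one {T : ℂ[X]} {M : ℝ} (hM : ∀ z : ℂ, ‖z‖ = 1 → ‖T.eval z‖ ≤ M)
    {z : ℂ} (hz : ‖z‖ ≤ 1) : ‖T.eval z‖ ≤ M := by
  refine Complex.norm_le_of_forall_mem_frontier_norm_le (f := fun z => T.eval z)
    (U := Metric.ball 0 1) Metric.isBounded_ball T.differentiable.diffContOnCl ?_ ?_
  · intro w hw
    rw [frontier_ball _ one_ne_zero] at hw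
    exact hM w (by simpa using hw)
  · rw [closure_ball _ one_ne_zero]
    simpa using hz

theorem eval_reflect_inv_mul_pow {f : ℂ[X]} {N : ℕ} (hf : f.natDegree ≤ N) {x : ℂ} (hx : x ≠ 0) :
    (f.reflect N).eval x⁻¹ * x ^ N = f.eval x := by
  let := invertibleOfNonzero hx
  have := eval₂_reflect_mul_pow (RingHom.id ℂ) x N f hf
  rwa [invOf_eq_inv] at this

/-- Minimum principle for `T(z) / zⁿ` outside the unit disc. -/
theorem le_norm_eval_reflect {T : ℂ[X]} (hT0 : T ≠ 0) (hT : ∀ w, T.eval w = 0 → ‖w‖ ≤ 1) {m : ℝ}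
    (hm0 : 0 < m) (hm : ∀ z : ℂ, ‖z‖ = 1 → m ≤ ‖T.eval z‖) {x : ℂ} (hx : ‖x‖ ≤ 1) :
    m ≤ ‖(T.reflect T.natDegree).eval x‖ := by
  set q := T.reflect T.natDegree with hq
  have hqe : ∀ y : ℂ, y ≠ 0 → q.eval y = T.eval y⁻¹ * y ^ T.natDegree := fun y hy => by
    have := eval_reflect_inv_mul_pow (f := T) le_rfl (inv_ne_zero hy)
    rw [inv_inv] at this
    rw [← this, mul_assoc, ← mul_pow, inv_mul_cancel₀ hy, one_pow, mul_one]
  have hne : ∀ y : ℂ, ‖y‖ ≤ 1 → q.eval y ≠ 0 := by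
    intro y hy
    rcases eq_or_ne y 0 with rfl | hy0
    · rw [← coeff_zero_eq_eval_zero, hq, coeff_reflect]
      simpa using hT0
    rw [hqe y hy0]
    refine mul_ne_zero (fun h => ?_) (pow_ne_zero _ hy0)
    -- A zero `y` of `q` in the disc would give a zero `y⁻¹` of `T` on the unit circle itself, which
    -- `m > 0` forbids.
    have h1 := hT _ h
    rw [norm_inv] at h1
    have h2 : ‖y⁻¹‖ = 1 := by
      rw [norm_inv]
      exact le_antisymm h1 ((one_le_inv₀ (norm_pos_iff.2 hy0)).2 hy)
    have := hm _ h2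
    rw [h, norm_zero] at this
    linarith
  have hcl : closure (Metric.ball (0 : ℂ) 1) = Metric.closedBall 0 1 := closure_ball _ one_ne_zero
  have := Complex.norm_le_of_forall_mem_frontier_norm_le (f := fun z => (q.eval z)⁻¹)
    (U := Metric.ball 0 1) (C := m⁻¹) Metric.isBounded_ball
    (q.differentiable.diffContOnCl.inv fun z hz => hne z (by rw [hcl] at hz; simpa using hz))
    (by
      intro w hw
      rw [frontier_ball _ one_ne_zero] at hw
      have hw1 : ‖w‖ = 1 := by simpa using hw
      have hw0 : w ≠ 0 := by rintro rfl; simp at hw1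
      rw [norm_inv, hqe w hw0, norm_mul, norm_pow, hw1, one_pow, mul_one]
      exact inv_anti₀ hm0 (hm _ (by rw [norm_inv, hw1, inv_one])))
    (z := x) (by rw [hcl]; simpa using hx)
  rw [norm_inv] at this
  exact (inv_le_inv₀ (norm_pos_iff.2 (hne x hx)) hm0).1 this

theorem exists_norm_one_mul_eq_norm (a : ℂ) : ∃ s : ℂ, ‖s‖ = 1 ∧ a = s * ‖a‖ := by
  rcases eq_or_ne a 0 with rfl | ha
  · exact ⟨1, by simp, by simp⟩
  · have : (‖a‖ : ℂ) ≠ 0 := by simpa using ha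
    exact ⟨a / ‖a‖, by simp [ha], by field_simp⟩

/-- For `x > M` and `|s| = 1`, the maximum principle keeps the zeros of `T - s x` out of the open
disc, so the reflection inequality applies to it. Giving `s` the phase of `T(u)` makes `|T(u) - s x|
= x - |T(u)|`; then `x` tends to `M`. -/
theorem norm_pow_mul_norm_eval_add_norm_eval_le {T : ℂ[X]} {n : ℕ} (hn : T.natDegree ≤ n) {M : ℝ}
    (hM : ∀ z : ℂ, ‖z‖ = 1 → ‖T.eval z‖ ≤ M) {u : ℂ} (hu : u ≠ 0) (hu1 : ‖u‖ ≤ 1) :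
    ‖u‖ ^ n * ‖T.eval (conj u)⁻¹‖ + ‖T.eval u‖ ≤ (1 + ‖u‖ ^ n) * M := by
  obtain ⟨s, hs, hsT⟩ := exists_norm_one_mul_eq_norm (T.eval u)
  have hr : 0 < 1 + ‖u‖ ^ n := by positivity
  have key : ∀ x, M < x → ‖u‖ ^ n * ‖T.eval (conj u)⁻¹‖ + ‖T.eval u‖ ≤ (1 + ‖u‖ ^ n) * x := by
    intro x hx
    have hTu := norm_eval_le_of_norm_le_one hM hu1
    have hx0 : 0 < x := ((norm_nonneg _).trans hTu).trans_lt hx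
    have h := norm_pow_mul_norm_eval_conj_inv_le_of_one_le_roots (f := T - C (s * x)) (n := n)
      (by rw [natDegree_sub_C]; exact hn) (fun w hw => by
        by_contra! hlt
        have h1 := norm_eval_le_of_norm_le_one hM hlt.le
        rw [eval_sub, eval_C, sub_eq_zero] at hw
        rw [hw, norm_mul, hs, one_mul, Complex.norm_real, Real.norm_of_nonneg hx0.le] at h1
        linarith) hu hu1
    simp only [eval_sub, eval_C] at h
    have h2 : ‖T.eval u - s * x‖ = x - ‖T.eval u‖ := by
      rw [hsT, ← mul_sub, norm_mul, hs, one_mul, ← hsT, ← Complex.ofReal_sub, Complex.norm_real,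
        Real.norm_of_nonpos (by linarith)]
      ring
    have h3 : ‖T.eval (conj u)⁻¹‖ - x ≤ ‖T.eval (conj u)⁻¹ - s * x‖ := by
      have := norm_sub_norm_le (T.eval (conj u)⁻¹) (s * x)
      rwa [norm_mul, hs, one_mul, Complex.norm_real, Real.norm_of_nonneg hx0.le] at this
    have h4 := mul_le_mul_of_nonneg_left h3 (pow_nonneg (norm_nonneg u) n)
    linarith
  have : (‖u‖ ^ n * ‖T.eval (conj u)⁻¹‖ + ‖T.eval u‖) / (1 + ‖u‖ ^ n) ≤ M :=
    le_of_forall_gt_imp_ge_of_dense fun x hx => by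
      rw [div_le_iff₀ hr, mul_comm x]
      exact key x hx
  rwa [div_le_iff₀ hr, mul_comm M] at this

/-- The counterpart for the minimum: for `0 < y < m` the polynomial `T - s y Xⁿ` has its zeros in
the closed disc, because `|T(z)| ≥ m|z|ⁿ` outside. Here `s` carries the phase of `T(v)/vⁿ`, and `y`
tends to `m`. -/
theorem norm_eval_add_le_norm_pow_mul {T : ℂ[X]} (hT0 : T ≠ 0)
    (hT : ∀ w, T.eval w = 0 → ‖w‖ ≤ 1) {m : ℝ} (hm : ∀ z : ℂ, ‖z‖ = 1 → m ≤ ‖T.eval z‖) {u : ℂ}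
    (hu : u ≠ 0) (hu1 : ‖u‖ ≤ 1) :
    ‖T.eval u‖ + (1 - ‖u‖ ^ T.natDegree) * m ≤
      ‖u‖ ^ T.natDegree * ‖T.eval (conj u)⁻¹‖ := by
  set n := T.natDegree with hn
  have hun : ‖u‖ ^ n ≤ 1 := pow_le_one₀ (norm_nonneg u) hu1
  rcases le_or_gt m 0 with hm0 | hm0
  · have := norm_eval_le_of_roots_le_one hT hu hu1
    nlinarith
  have hout : ∀ z : ℂ, 1 ≤ ‖z‖ → m * ‖z‖ ^ n ≤ ‖T.eval z‖ := by
    intro z hz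
    have hz0 : z ≠ 0 := norm_pos_iff.1 (by linarith)
    have h := le_norm_eval_reflect hT0 hT hm0 hm (x := z⁻¹) (by
      rw [norm_inv]; exact inv_le_one_of_one_le₀ hz)
    rw [← eval_reflect_inv_mul_pow (f := T) le_rfl hz0, norm_mul, norm_pow]
    gcongr
  have hlead : m ≤ ‖T.coeff n‖ := by
    have h := le_norm_eval_reflect hT0 hT hm0 hm (x := 0) (by simp)
    rw [← coeff_zero_eq_eval_zero, coeff_reflect, revAt_zero] at h
    exact h
  set v := (conj u)⁻¹ with hv
  have hnu : 0 < ‖u‖ := norm_pos_iff.2 hu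
  have hv1 : ‖v‖ = ‖u‖⁻¹ := by rw [hv, norm_inv, Complex.norm_conj]
  have hv0 : v ≠ 0 := inv_ne_zero (by simpa using hu)
  have huv : ‖u‖ ^ n * ‖v‖ ^ n = 1 := by
    rw [hv1, ← mul_pow, mul_inv_cancel₀ hnu.ne', one_pow]
  obtain ⟨s, hs, hsT⟩ := exists_norm_one_mul_eq_norm (T.eval v / v ^ n)
  have key : ∀ y, 0 < y → y < m →
      ‖T.eval u‖ + (1 - ‖u‖ ^ n) * y ≤ ‖u‖ ^ n * ‖T.eval v‖ := by
    intro y hy0 hy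
    have hny : ‖s * (y : ℂ)‖ = y := by
      rw [norm_mul, hs, one_mul, Complex.norm_real, Real.norm_of_nonneg hy0.le]
    -- The degree must stay `n` for the exponent in the reflection inequality; `y < m ≤ |aₙ|`
    -- ensures it.
    have hcoeff : (T - C (s * y) * X ^ n).coeff n ≠ 0 := by
      rw [coeff_sub, coeff_C_mul, coeff_X_pow_self, mul_one, sub_ne_zero]
      intro h
      rw [h, hny] at hlead
      linarith
    have hdeg : (T - C (s * y) * X ^ n).natDegree = n := by
      refine le_antisymm ?_ (le_natDegree_of_ne_zero hcoeff)
      exact (natDegree_sub_le _ _).trans (max_le hn.ge (natDegree_C_mul_X_pow_le _ _))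
    have h := norm_eval_le_of_roots_le_one (f := T - C (s * y) * X ^ n) (fun w hw => by
      by_contra! hlt
      have h1 := hout w hlt.le
      rw [eval_sub, sub_eq_zero] at hw
      rw [hw, eval_mul, eval_C, eval_pow, eval_X, norm_mul, hny, norm_pow] at h1
      have : 0 < ‖w‖ ^ n := by positivity
      nlinarith) hu hu1
    rw [hdeg] at h
    simp only [eval_sub, eval_mul, eval_C, eval_pow, eval_X] at h
    have h2 : ‖T.eval v - s * y * v ^ n‖ = ‖T.eval v‖ - y * ‖v‖ ^ n := by
      have hge := hout v (by rw [hv1]; exact (one_le_inv₀ hnu).2 hu1)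
      have hvn : 0 < ‖v‖ ^ n := by positivity
      have e : T.eval v - s * y * v ^ n = s * ((‖T.eval v / v ^ n‖ - y : ℝ) : ℂ) * v ^ n := by
        rw [Complex.ofReal_sub, mul_sub, ← hsT]
        field_simp
      rw [e, norm_mul, norm_mul, hs, one_mul, Complex.norm_real, norm_pow, norm_div, norm_pow,
        Real.norm_of_nonneg]
      · field_simp
      · rw [sub_nonneg, le_div_iff₀ hvn]
        nlinarith
    have h3 : ‖T.eval u‖ - y * ‖u‖ ^ n ≤ ‖T.eval u - s * y * u ^ n‖ := by
      have := norm_sub_norm_le (T.eval u) (s * y * u ^ n)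
      rwa [norm_mul, hny, norm_pow] at this
    rw [h2, mul_sub] at h
    have : ‖u‖ ^ n * (y * ‖v‖ ^ n) = y := by linear_combination y * huv
    linarith
  rcases hun.eq_or_lt with h1 | h1
  · have := key (m / 2) (by linarith) (by linarith)
    rw [h1] at this ⊢
    linarith
  · have hr : 0 < 1 - ‖u‖ ^ n := by linarith
    have : m ≤ (‖u‖ ^ n * ‖T.eval v‖ - ‖T.eval u‖) / (1 - ‖u‖ ^ n) := by
      refine le_of_forall_lt_imp_le_of_dense fun y hy => ?_
      rw [le_div_iff₀ hr]
      rcases le_or_gt y 0 with hy0 | hy0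
      · have := key (m / 2) (by linarith) (by linarith)
        nlinarith
      · have := key y hy0 hy
        linarith
    rw [le_div_iff₀ hr] at this
    linarith

theorem two_mul_norm_eval_le {T : ℂ[X]} (hT0 : T ≠ 0) (hT : ∀ w, T.eval w = 0 → ‖w‖ ≤ 1)
    {m M : ℝ} (hm : ∀ z : ℂ, ‖z‖ = 1 → m ≤ ‖T.eval z‖) (hM : ∀ z : ℂ, ‖z‖ = 1 → ‖T.eval z‖ ≤ M)
    {u : ℂ} (hu : u ≠ 0) (hu1 : ‖u‖ ≤ 1) :
    2 * ‖T.eval u‖ ≤ (1 + ‖u‖ ^ T.natDegree) * M - (1 - ‖u‖ ^ T.natDegree) * m := by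
  have h1 := norm_eval_add_le_norm_pow_mul hT0 hT hm hu hu1
  have h2 := norm_pow_mul_norm_eval_add_norm_eval_le (n := T.natDegree) le_rfl hM hu hu1
  linarith

end Reflection

/-! ### Interpolation at the solutions of a Blaschke equation. -/

section Interpolation
open ComplexConjugate

/-- The numerator of `z ^ (d + 1) * (z - u) / (1 - conj u * z) - s`. -/
noncomputable def nodePoly (d : ℕ) (u s : ℂ) : ℂ[X] :=
  X ^ (d + 1) * (X - C u) - C s * (1 - C (conj u) * X)

theorem eval_nodePoly (d : ℕ) (u s z : ℂ) :
    (nodePoly d u s).eval z = z ^ (d + 1) * (z - u) - s * (1 - conj u * z) := by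
  simp [nodePoly]

theorem natDegree_nodePoly_lower (s u : ℂ) : (C s * (1 - C (conj u) * X) : ℂ[X]).natDegree ≤ 1 := by
  refine (natDegree_C_mul_le _ _).trans ((natDegree_sub_le _ _).trans ?_)
  simpa using (natDegree_C_mul_le (conj u) (X : ℂ[X])).trans natDegree_X_le

/-- The exponent `d + 1 ≥ 1` keeps the linear term in `conj u` below the leading one; this is why
linear polynomials are treated separately. -/
theorem monic_nodePoly (d : ℕ) (u s : ℂ) : (nodePoly d u s).Monic := by
  refine Monic.sub_of_left ((monic_X_pow _).mul (monic_X_sub_C u)) ?_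
  refine lt_of_le_of_lt (natDegree_le_iff_degree_le.1 (natDegree_nodePoly_lower s u)) ?_
  rw [degree_mul, degree_X_pow, degree_X_sub_C]
  exact_mod_cast (by omega : 1 < d + 1 + 1)

theorem natDegree_nodePoly (d : ℕ) (u s : ℂ) : (nodePoly d u s).natDegree = d + 2 := by
  have h : (X ^ (d + 1) * (X - C u) : ℂ[X]).natDegree = d + 2 := by
    rw [(monic_X_pow _).natDegree_mul (monic_X_sub_C u), natDegree_X_pow, natDegree_X_sub_C]
  rw [nodePoly, natDegree_sub_eq_left_of_natDegree_lt, h]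
  rw [h]
  exact (natDegree_nodePoly_lower s u).trans_lt (by omega)

variable {d : ℕ} {u s z : ℂ}

/-- The Blaschke product has modulus below 1 inside the disc and above 1 outside, so it can equal
`s` only on the circle. -/
theorem norm_eq_one_of_eval_nodePoly_eq_zero (hu : ‖u‖ < 1) (hs : ‖s‖ = 1)
    (hz : (nodePoly d u s).eval z = 0) : ‖z‖ = 1 := by
  rw [eval_nodePoly, sub_eq_zero] at hz
  have h := congrArg (‖·‖) hz
  simp only [norm_mul, norm_pow, hs, one_mul] at h
  have e := norm_one_sub_conj_mul_sq_sub u z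
  rw [norm_sub_rev u z, ← h] at e
  have hu2 : 0 < 1 - ‖u‖ ^ 2 := by nlinarith [norm_nonneg u]
  have hfac : ((‖z‖ ^ (d + 1)) ^ 2 - 1) * ‖z - u‖ ^ 2 = (1 - ‖u‖ ^ 2) * (1 - ‖z‖ ^ 2) := by
    rw [← e]; ring
  rcases lt_trichotomy ‖z‖ 1 with h1 | h1 | h1
  · have h2 : (‖z‖ ^ (d + 1)) ^ 2 ≤ 1 :=
      pow_le_one₀ (by positivity) (pow_le_one₀ (norm_nonneg z) h1.le)
    have h3 : 0 < 1 - ‖z‖ ^ 2 := by nlinarith [norm_nonneg z]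
    have := mul_pos hu2 h3
    have := mul_nonneg (sub_nonneg.2 h2) (sq_nonneg ‖z - u‖)
    linarith
  · exact h1
  · have h2 : 1 ≤ (‖z‖ ^ (d + 1)) ^ 2 := one_le_pow₀ (one_le_pow₀ h1.le)
    have h3 : 0 < ‖z‖ ^ 2 - 1 := by nlinarith
    have := mul_pos hu2 h3
    have := mul_nonneg (sub_nonneg.2 h2) (sq_nonneg ‖z - u‖)
    linarith

/-- For the Blaschke product `B`, on the circle `zB'/B = d + 1 + (1 - |u|²)/|z - u|²`. Positivity of
this makes the nodes simple and the interpolation weights positive. -/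
theorem sub_mul_eval_derivative_nodePoly (hz1 : ‖z‖ = 1)
    (hz : (nodePoly d u s).eval z = 0) :
    (z - u) * (derivative (nodePoly d u s)).eval z =
      s * (((d + 1) * ‖z - u‖ ^ 2 + (1 - ‖u‖ ^ 2) : ℝ) : ℂ) := by
  have hzz : z * conj z = 1 := by rw [Complex.mul_conj, Complex.normSq_eq_norm_sq, hz1]; simp
  have e1 : ((‖z - u‖ ^ 2 : ℝ) : ℂ) = (z - u) * (conj z - conj u) := by
    rw [← Complex.normSq_eq_norm_sq, ← Complex.mul_conj, map_sub]
  have e2 : ((‖u‖ ^ 2 : ℝ) : ℂ) = u * conj u := by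
    rw [← Complex.normSq_eq_norm_sq, ← Complex.mul_conj]
  rw [eval_nodePoly] at hz
  rw [Complex.ofReal_add, Complex.ofReal_mul, Complex.ofReal_sub, e1, e2]
  have hd : (derivative (nodePoly d u s)).eval z =
      (d + 1) * z ^ d * (z - u) + z ^ (d + 1) + s * conj u := by
    simp [nodePoly]
  rw [hd]
  push_cast
  rw [pow_succ] at hz ⊢
  linear_combination (1 + (d + 1) * conj z * (z - u)) * hz +
    (-(d + 1) * z ^ d * (z - u) ^ 2 - (d + 1) * s * conj u * (z - u)) * hzz

theorem weight_pos (hu : ‖u‖ < 1) (z : ℂ) :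
    0 < ((d : ℝ) + 1) * ‖z - u‖ ^ 2 + (1 - ‖u‖ ^ 2) := by
  have : 0 < 1 - ‖u‖ ^ 2 := by nlinarith [norm_nonneg u]
  positivity

theorem eval_derivative_nodePoly_ne_zero (hu : ‖u‖ < 1) (hs : ‖s‖ = 1)
    (hz : (nodePoly d u s).eval z = 0) : (derivative (nodePoly d u s)).eval z ≠ 0 := by
  intro h
  have e := sub_mul_eval_derivative_nodePoly (norm_eq_one_of_eval_nodePoly_eq_zero hu hs hz) hz
  rw [h, mul_zero] at e
  have hs0 : s ≠ 0 := by rintro rfl; simp at hs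
  rcases mul_eq_zero.1 e.symm with h | h
  · exact hs0 h
  · exact (weight_pos (d := d) hu z).ne' (Complex.ofReal_eq_zero.1 h)

theorem nodup_roots_nodePoly (hu : ‖u‖ < 1) (hs : ‖s‖ = 1) : (nodePoly d u s).roots.Nodup := by
  classical
  rw [Multiset.nodup_iff_count_le_one]
  intro z
  rw [count_roots]
  by_contra! h
  have h0 := (monic_nodePoly d u s).ne_zero
  obtain ⟨h1, h2⟩ := (one_lt_rootMultiplicity_iff_isRoot h0).1 h
  exact eval_derivative_nodePoly_ne_zero hu hs h1 h2

/-- The quantity inside the norm is a convex combination of the values of `q` at the roots of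
`nodePoly d u s`. -/
theorem norm_eval_add_mul_coeff_le {q : ℂ[X]} (hq : q.natDegree ≤ d + 2) {M : ℝ}
    (hM : ∀ z : ℂ, ‖z‖ = 1 → ‖q.eval z‖ ≤ M) (hu : ‖u‖ < 1) (hs : ‖s‖ = 1) :
    ‖q.eval u + s * (1 - ‖u‖ ^ 2 : ℝ) * q.coeff (d + 2)‖ ≤ M := by
  classical
  set D := nodePoly d u s with hD
  set S := D.roots.toFinset with hS
  have hD0 : D ≠ 0 := (monic_nodePoly d u s).ne_zero
  have hmem : ∀ z ∈ S, D.eval z = 0 := fun z hz =>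
    (mem_roots hD0).1 (Multiset.mem_toFinset.1 hz)
  have hcard : S.card = d + 2 := by
    rw [hS, Multiset.toFinset_card_of_nodup (nodup_roots_nodePoly hu hs),
      ← (IsAlgClosed.splits D).natDegree_eq_card_roots, natDegree_nodePoly]
  have hnodal : Lagrange.nodal S id = D := by
    rw [(IsAlgClosed.splits D).eq_prod_roots_of_monic (monic_nodePoly d u s), Lagrange.nodal,
      Finset.prod, hS, Multiset.toFinset_val, (nodup_roots_nodePoly hu hs).dedup]
    rfl
  have hinj : Set.InjOn (id : ℂ → ℂ) S := Function.injective_id.injOn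
  have hone : ∀ z ∈ S, ‖z‖ = 1 := fun z hz =>
    norm_eq_one_of_eval_nodePoly_eq_zero hu hs (hmem z hz)
  have hne : ∀ z ∈ S, u ≠ id z := fun z hz h => by
    have := hone z hz
    rw [id] at h
    rw [← h] at this
    linarith
  have hDu : D.eval u = -(s * (1 - ‖u‖ ^ 2 : ℝ)) := by
    rw [hD, eval_nodePoly, Complex.ofReal_sub, ← Complex.normSq_eq_norm_sq, ← Complex.mul_conj]
    push_cast
    ring
  set w : ℂ → ℝ := fun z => (1 - ‖u‖ ^ 2) / ((d + 1) * ‖z - u‖ ^ 2 + (1 - ‖u‖ ^ 2)) with hw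
  have hw0 : ∀ z, 0 ≤ w z := fun z =>
    div_nonneg (by nlinarith [norm_nonneg u]) (weight_pos hu z).le
  -- The phase `s` in `D(u)` cancels the one in `D'(z)`, leaving the real weights `w z`.
  have hval : ∀ r : ℂ → ℂ, (Lagrange.interpolate S id r).eval u = ∑ z ∈ S, w z * r z := by
    intro r
    rw [Lagrange.eval_interpolate_not_at_node r hne, hnodal, Finset.mul_sum]
    refine Finset.sum_congr rfl fun z hz => ?_
    rw [Lagrange.nodalWeight_eq_eval_derivative_nodal hz, hnodal, hDu, ← mul_assoc]
    congr 1
    have e := sub_mul_eval_derivative_nodePoly (hone z hz) (hmem z hz)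
    have hd := eval_derivative_nodePoly_ne_zero hu hs (hmem z hz)
    have hzu : z - u ≠ 0 := sub_ne_zero.2 (hne z hz).symm
    have hzu' : u - z ≠ 0 := sub_ne_zero.2 (hne z hz)
    have hW : (((d + 1) * ‖z - u‖ ^ 2 + (1 - ‖u‖ ^ 2) : ℝ) : ℂ) ≠ 0 :=
      Complex.ofReal_ne_zero.2 (weight_pos hu z).ne'
    simp only [hw, id, Complex.ofReal_div]
    rw [← hD] at e hd
    rw [eq_div_iff hW]
    have : -(s * ((1 - ‖u‖ ^ 2 : ℝ) : ℂ)) *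
        ((eval z (derivative D))⁻¹ * (u - z)⁻¹) *
          (((d + 1) * ‖z - u‖ ^ 2 + (1 - ‖u‖ ^ 2) : ℝ) : ℂ) =
        -((1 - ‖u‖ ^ 2 : ℝ) : ℂ) * ((z - u) * eval z (derivative D)) *
          ((eval z (derivative D))⁻¹ * (u - z)⁻¹) := by
      rw [e]; ring
    rw [this]
    field_simp
    ring
  have hsum : ∑ z ∈ S, w z = 1 := by
    have h := hval 1
    rw [Lagrange.interpolate_one hinj (Finset.card_pos.1 (by omega)), eval_one] at h
    simp only [Pi.one_apply, mul_one] at h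
    exact_mod_cast h.symm
  -- Subtracting this multiple of `D` lowers the degree below the number of nodes without changing
  -- the values there.
  have hinterp : q - C (q.coeff (d + 2)) * D = Lagrange.interpolate S id fun z => q.eval z := by
    refine Lagrange.eq_interpolate_of_eval_eq _ hinj ?_ fun z hz => ?_
    · rw [hcard]
      refine (degree_lt_iff_coeff_zero _ _).2 fun i hi => ?_
      rcases hi.eq_or_lt with rfl | hi
      · have : D.coeff (d + 2) = 1 := by
          have := (monic_nodePoly d u s).coeff_natDegree
          rwa [natDegree_nodePoly] at this
        rw [coeff_sub, coeff_C_mul, this, mul_one, sub_self]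
      · have : D.coeff i = 0 :=
          coeff_eq_zero_of_natDegree_lt (by rw [hD, natDegree_nodePoly]; exact hi)
        rw [coeff_sub, coeff_C_mul, coeff_eq_zero_of_natDegree_lt (hq.trans_lt hi), this,
          mul_zero, sub_zero]
    · simp [hmem z hz]
  have heq : q.eval u + s * (1 - ‖u‖ ^ 2 : ℝ) * q.coeff (d + 2) = ∑ z ∈ S, w z * q.eval z := by
    rw [← hval, ← hinterp, eval_sub, eval_mul, eval_C, hDu]
    ring
  rw [heq]
  calc ‖∑ z ∈ S, (w z : ℂ) * q.eval z‖ ≤ ∑ z ∈ S, w z * M := by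
        refine norm_sum_le_of_le _ fun z hz => ?_
        rw [norm_mul, Complex.norm_real, Real.norm_of_nonneg (hw0 z)]
        exact mul_le_mul_of_nonneg_left (hM z (hone z hz)) (hw0 z)
    _ = M := by rw [← Finset.sum_mul, hsum, one_mul]

theorem norm_add_norm_le_of_forall {a b : ℂ} {M : ℝ}
    (h : ∀ s : ℂ, ‖s‖ = 1 → ‖a + s * b‖ ≤ M) : ‖a‖ + ‖b‖ ≤ M := by
  obtain ⟨s, hs, hsa⟩ := exists_norm_one_mul_eq_norm a
  obtain ⟨t, ht, htb⟩ := exists_norm_one_mul_eq_norm b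
  have ht0 : t ≠ 0 := by rintro rfl; simp at ht
  have := h (s / t) (by rw [norm_div, hs, ht, div_one])
  have e : a + s / t * b = s * ((‖a‖ + ‖b‖ : ℝ) : ℂ) := by
    rw [Complex.ofReal_add, mul_add, ← hsa]
    nth_rewrite 1 [htb]
    field_simp
  rwa [e, norm_mul, hs, one_mul, Complex.norm_real, Real.norm_of_nonneg (by positivity)] at this

theorem norm_eval_add_norm_coeff_le {q : ℂ[X]} (hq : q.natDegree ≤ d + 2) {M : ℝ}
    (hM : ∀ z : ℂ, ‖z‖ = 1 → ‖q.eval z‖ ≤ M) (hu : ‖u‖ < 1) :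
    ‖q.eval u‖ + (1 - ‖u‖ ^ 2) * ‖q.coeff (d + 2)‖ ≤ M := by
  have h := norm_add_norm_le_of_forall (a := q.eval u)
    (b := (1 - ‖u‖ ^ 2 : ℝ) * q.coeff (d + 2)) (M := M) fun s hs => by
      rw [← mul_assoc]
      exact norm_eval_add_mul_coeff_le hq hM hu hs
  rwa [norm_mul, Complex.norm_real,
    Real.norm_of_nonneg (by nlinarith [norm_nonneg u])] at h

end Interpolation

/-! ### Growth from the unit circle to `|z| = k`. -/

/-- Growth of a polynomial of degree at most `d + 2` outside the unit disc. -/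
theorem norm_eval_le_pow_mul_sub {p : ℂ[X]} {d : ℕ} (hp : p.natDegree ≤ d + 2) {M k : ℝ}
    (hk : 1 ≤ k) (hM : ∀ z : ℂ, ‖z‖ = 1 → ‖p.eval z‖ ≤ M) {z : ℂ} (hz : ‖z‖ = k) :
    ‖p.eval z‖ ≤ k ^ (d + 2) * (M - (1 - 1 / k ^ 2) * ‖p.coeff 0‖) := by
  rcases hk.eq_or_lt with rfl | hk1
  · simpa using hM z hz
  have hz0 : z ≠ 0 := norm_pos_iff.1 (by linarith)
  have hqd : (p.reflect (d + 2)).natDegree ≤ d + 2 := by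
    rw [natDegree_le_iff_coeff_eq_zero]
    intro N hN
    rw [coeff_reflect, revAt_eq_self_of_lt hN]
    exact coeff_eq_zero_of_natDegree_lt (hp.trans_lt hN)
  have hqM : ∀ x : ℂ, ‖x‖ = 1 → ‖(p.reflect (d + 2)).eval x‖ ≤ M := fun x hx => by
    have hx0 : x ≠ 0 := norm_pos_iff.1 (by linarith)
    have := hM x⁻¹ (by rw [norm_inv, hx, inv_one])
    rwa [← eval_reflect_inv_mul_pow hp (inv_ne_zero hx0), inv_inv, norm_mul, norm_pow, norm_inv,
      hx, inv_one, one_pow, mul_one] at this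
  -- Reversal sends `z` to the interior point `z⁻¹` and the constant coefficient of `p` to the
  -- coefficient of degree `d + 2`.
  have h := norm_eval_add_norm_coeff_le hqd hqM (u := z⁻¹) (by
    rw [norm_inv, hz]; exact inv_lt_one_of_one_lt₀ hk1)
  have hc : (p.reflect (d + 2)).coeff (d + 2) = p.coeff 0 := by simp [coeff_reflect]
  rw [hc, norm_inv, hz, inv_pow, ← one_div (k ^ 2)] at h
  rw [← eval_reflect_inv_mul_pow hp hz0, norm_mul, norm_pow, hz, mul_comm]
  gcongr
  linarith

theorem norm_eval_le_mul_sub_of_natDegree_le_one {p : ℂ[X]} (hp : p.natDegree ≤ 1) {M k : ℝ}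
    (hk : 1 ≤ k) (hM : ∀ z : ℂ, ‖z‖ = 1 → ‖p.eval z‖ ≤ M) {z : ℂ} (hz : ‖z‖ = k) :
    ‖p.eval z‖ ≤ k * (M - (1 - 1 / k) * ‖p.coeff 0‖) := by
  have he : ∀ x, p.eval x = p.coeff 0 + x * p.coeff 1 := fun x => by
    conv_lhs => rw [eq_X_add_C_of_natDegree_le_one hp]
    simp
    ring
  have h := norm_add_norm_le_of_forall (a := p.coeff 0) (b := p.coeff 1) (M := M) fun s hs => by
    rw [← he]; exact hM s hs
  have hk0 : 0 < k := by linarith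
  have h1 : ‖p.eval z‖ ≤ ‖p.coeff 0‖ + k * ‖p.coeff 1‖ := by
    rw [he, ← hz, ← norm_mul]
    exact norm_add_le _ _
  have h2 : k * (M - (1 - 1 / k) * ‖p.coeff 0‖) = k * M - (k - 1) * ‖p.coeff 0‖ := by
    field_simp
  rw [h2]
  nlinarith

/-! ### Extremal moduli and the assembly of the bound. -/

theorem norm_eval_le_maxModulus (P : ℂ[X]) {z : ℂ} {r : ℝ} (hz : ‖z‖ = r) :
    ‖P.eval z‖ ≤ maxModulus P r :=
  (isGreatest_maxModulus P (hz ▸ norm_nonneg z)).2 ⟨z, by simpa using hz, rfl⟩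

theorem exists_norm_eval_eq_maxModulus (P : ℂ[X]) {r : ℝ} (hr : 0 ≤ r) :
    ∃ z : ℂ, ‖z‖ = r ∧ ‖P.eval z‖ = maxModulus P r := by
  obtain ⟨z, hz, h⟩ := (isGreatest_maxModulus P hr).1
  exact ⟨z, by simpa using hz, h⟩

theorem minModulus_le_norm_eval (P : ℂ[X]) {z : ℂ} {r : ℝ} (hz : ‖z‖ = r) :
    minModulus P r ≤ ‖P.eval z‖ :=
  (isLeast_minModulus P (hz ▸ norm_nonneg z)).2 ⟨z, by simpa using hz, rfl⟩

theorem coeffFactor_nonneg {n : ℕ} (hn : 1 ≤ n) {k : ℝ} (hk : 0 ≤ k) (P : ℂ[X]) :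
    0 ≤ coeffFactor n k P := by
  have h : -1 ≤ (k ^ n * ‖P.coeff n‖ - ‖P.coeff 0‖) / (k ^ n * ‖P.coeff n‖ + ‖P.coeff 0‖) := by
    have h1 : 0 ≤ k ^ n * ‖P.coeff n‖ := by positivity
    have h2 := norm_nonneg (P.coeff 0)
    rcases (add_nonneg h1 h2).eq_or_lt with h0 | h0
    · rw [← h0, div_zero]; norm_num
    · rw [le_div_iff₀ h0]; linarith
  have : (1 : ℝ) ≤ n := by exact_mod_cast hn
  rw [coeffFactor]
  linarith

theorem two_mul_pow_mul_maxModulus_le {n : ℕ} {k : ℝ} (hk : 1 ≤ k) {P : ℂ[X]}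
    (hn : P.natDegree = n) (hP0 : P ≠ 0) (hP : ∀ z : ℂ, P.eval z = 0 → ‖z‖ ≤ k) :
    2 * k ^ n * maxModulus P 1 + (k ^ n - 1) * minModulus P k ≤ (k ^ n + 1) * maxModulus P k := by
  have hk0 : 0 < k := by linarith
  have hkc : (k : ℂ) ≠ 0 := Complex.ofReal_ne_zero.2 hk0.ne'
  have hnk : ‖(k : ℂ)‖ = k := by rw [Complex.norm_real, Real.norm_of_nonneg hk0.le]
  obtain ⟨z, hz, hzM⟩ := exists_norm_eval_eq_maxModulus P zero_le_one
  have hz0 : z ≠ 0 := by rintro rfl; simp at hz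
  set T := P.comp (C (k : ℂ) * X) with hT
  have hTe : ∀ w, T.eval w = P.eval (k * w) := fun w => by simp [hT, eval_comp]
  have hTn : T.natDegree = n := by
    rw [hT, natDegree_comp, natDegree_C_mul_X _ hkc, mul_one, hn]
  -- Rescaling brings the zeros into the unit disc; the reflection bound is used at `u = z/k`, where
  -- `T(u) = P(z)`.
  have hT0 : T ≠ 0 := by
    intro h
    have h1 := hTe (z / k)
    rw [h, eval_zero, mul_div_cancel₀ z hkc] at h1
    refine hP0 (funext fun w => ?_)
    have h2 := hTe (w / k)
    rwa [h, eval_zero, mul_div_cancel₀ w hkc, eq_comm, ← eval_zero (x := w)] at h2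
  have hnorm : ∀ w : ℂ, ‖w‖ = 1 → ‖(k : ℂ) * w‖ = k := fun w hw => by
    rw [norm_mul, hnk, hw, mul_one]
  have h := two_mul_norm_eval_le hT0 (fun w hw => by
      have h1 := hP _ ((hTe w).symm.trans hw)
      rw [norm_mul, hnk] at h1
      exact (mul_le_iff_le_one_right hk0).1 h1)
    (fun w hw => by rw [hTe]; exact minModulus_le_norm_eval P (hnorm w hw))
    (fun w hw => by rw [hTe]; exact norm_eval_le_maxModulus P (hnorm w hw))
    (u := z / k) (div_ne_zero hz0 hkc)
    (by rw [norm_div, hz, hnk]; exact div_le_one_of_le₀ hk hk0.le)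
  rw [hTe, mul_div_cancel₀ z hkc, hzM, hTn, norm_div, hz, hnk, div_pow, one_pow] at h
  have hkn : 0 < k ^ n := pow_pos hk0 n
  have h2 := mul_le_mul_of_nonneg_left h hkn.le
  have e : k ^ n * ((1 + 1 / k ^ n) * maxModulus P k - (1 - 1 / k ^ n) * minModulus P k) =
      (k ^ n + 1) * maxModulus P k - (k ^ n - 1) * minModulus P k := by
    field_simp
  rw [e] at h2
  linarith

theorem mul_norm_eval_derivative_le {n : ℕ} (hn2 : 2 ≤ n) {k : ℝ} (hk : 1 ≤ k) {P : ℂ[X]}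
    (hn : P.natDegree = n) {z : ℂ} (hz : ‖z‖ = k) :
    k * ‖(derivative P).eval z‖ ≤
      k ^ n * (maxModulus (derivative P) 1 - psi n k * ‖P.coeff 1‖) := by
  have hc : (derivative P).coeff 0 = P.coeff 1 := by simp [coeff_derivative]
  have hd := natDegree_derivative_le P
  have hM : ∀ w : ℂ, ‖w‖ = 1 → ‖(derivative P).eval w‖ ≤ maxModulus (derivative P) 1 :=
    fun w hw => norm_eval_le_maxModulus _ hw
  have hk0 : 0 ≤ k := by linarith
  rcases hn2.eq_or_lt with h2 | h2
  · have h := norm_eval_le_mul_sub_of_natDegree_le_one (by omega) hk hM hz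
    rw [hc] at h
    subst h2
    rw [psi, if_neg (lt_irrefl _), pow_two, mul_assoc]
    exact mul_le_mul_of_nonneg_left h hk0
  · obtain ⟨d, rfl⟩ := Nat.exists_eq_add_of_le' (show 3 ≤ n from h2)
    have h := norm_eval_le_pow_mul_sub (d := d) (by omega) hk hM hz
    rw [hc] at h
    rw [psi, if_pos h2, show d + 3 = d + 2 + 1 from rfl, pow_succ' k (d + 2), mul_assoc]
    exact mul_le_mul_of_nonneg_left h hk0

theorem derivLowerBound_le_maxModulus {n : ℕ} (hn2 : 2 ≤ n) {k : ℝ} (hk : 1 ≤ k) {P : ℂ[X]}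
    (hn : P.natDegree = n) (hP : ∀ z : ℂ, P.eval z = 0 → ‖z‖ ≤ k) :
    derivLowerBound n k P ≤ maxModulus (derivative P) 1 := by
  have hk0 : 0 < k := by linarith
  have hP0 : P ≠ 0 := by
    rintro rfl
    rw [natDegree_zero] at hn
    omega
  obtain ⟨z, hz, hzM⟩ := exists_norm_eval_eq_maxModulus P hk0.le
  have hF := coeffFactor_nonneg (by omega : 1 ≤ n) hk0.le P
  have hA : coeffFactor n k P * maxModulus P k ≤ 2 * (k * ‖(derivative P).eval z‖) := by
    rw [← hzM]
    by_cases h0 : P.eval z = 0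
    · rw [h0, norm_zero, mul_zero]
      positivity
    · exact coeffFactor_mul_norm_eval_le hk0 hn hP hz h0
  have hB := mul_le_mul_of_nonneg_left (two_mul_pow_mul_maxModulus_le hk hn hP0 hP) hF
  have hC := mul_norm_eval_derivative_le hn2 hk hn hz
  have hkn : 0 < k ^ n := pow_pos hk0 n
  have hAC : (k ^ n + 1) * (coeffFactor n k P * maxModulus P k) ≤
      (k ^ n + 1) *
        (2 * (k ^ n * (maxModulus (derivative P) 1 - psi n k * ‖P.coeff 1‖))) :=
    mul_le_mul_of_nonneg_left (by linarith) (by positivity)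
  have e : derivLowerBound n k P =
      coeffFactor n k P * (2 * k ^ n * maxModulus P 1 + (k ^ n - 1) * minModulus P k) /
        (2 * k ^ n * (k ^ n + 1)) + psi n k * ‖P.coeff 1‖ := by
    rw [derivLowerBound, add_comm 1 (k ^ n)]
    field_simp
    ring
  rw [e, ← le_sub_iff_add_le, div_le_iff₀ (by positivity)]
  linarith

/-! ### Equality for `zⁿ + kⁿ`. -/

section Extremal

variable (n : ℕ) {k : ℝ}

theorem eval_X_pow_add_C (z : ℂ) :
    (X ^ n + C ((k : ℂ) ^ n) : ℂ[X]).eval z = z ^ n + (k : ℂ) ^ n := by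
  simp

theorem maxModulus_X_pow_add_C (hk : 0 ≤ k) :
    maxModulus (X ^ n + C ((k : ℂ) ^ n) : ℂ[X]) 1 = 1 + k ^ n := by
  have hk' : ‖(k : ℂ) ^ n‖ = k ^ n := by
    rw [norm_pow, Complex.norm_real, Real.norm_of_nonneg hk]
  refine (isGreatest_maxModulus _ zero_le_one).unique ⟨⟨1, by simp, ?_⟩, ?_⟩
  · have : (1 : ℂ) ^ n + (k : ℂ) ^ n = ((1 + k ^ n : ℝ) : ℂ) := by push_cast; rw [one_pow]
    simp only [eval_X_pow_add_C]
    rw [this, Complex.norm_real, Real.norm_of_nonneg (by positivity)]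
  · rintro _ ⟨z, hz, rfl⟩
    have hz1 : ‖z‖ = 1 := by simpa using hz
    simp only [eval_X_pow_add_C]
    refine (norm_add_le _ _).trans ?_
    rw [hk', norm_pow, hz1, one_pow]

theorem norm_eq_of_eval_X_pow_add_C_eq_zero (hn : n ≠ 0) (hk : 0 ≤ k) {z : ℂ}
    (hz : (X ^ n + C ((k : ℂ) ^ n) : ℂ[X]).eval z = 0) : ‖z‖ = k := by
  rw [eval_X_pow_add_C] at hz
  have h := congrArg (‖·‖) (eq_neg_of_add_eq_zero_left hz)
  simp only [norm_neg, norm_pow, Complex.norm_real, Real.norm_of_nonneg hk] at h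
  exact (pow_left_inj₀ (norm_nonneg z) hk hn).1 h

theorem minModulus_X_pow_add_C (hn : n ≠ 0) (hk : 0 ≤ k) :
    minModulus (X ^ n + C ((k : ℂ) ^ n) : ℂ[X]) k = 0 := by
  obtain ⟨z, hz⟩ := IsAlgClosed.exists_pow_nat_eq (-(k : ℂ) ^ n) (Nat.pos_of_ne_zero hn)
  have hz0 : (X ^ n + C ((k : ℂ) ^ n) : ℂ[X]).eval z = 0 := by
    rw [eval_X_pow_add_C, hz, neg_add_cancel]
  refine (isLeast_minModulus _ hk).unique ⟨⟨z, ?_, ?_⟩, ?_⟩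
  · simpa using norm_eq_of_eval_X_pow_add_C_eq_zero n hn hk hz0
  · simp only [hz0, norm_zero]
  · rintro _ ⟨w, -, rfl⟩
    exact norm_nonneg _

theorem maxModulus_derivative_X_pow_add_C :
    maxModulus (derivative (X ^ n + C ((k : ℂ) ^ n) : ℂ[X])) 1 = n := by
  have he : ∀ z : ℂ, ‖z‖ = 1 →
      ‖(derivative (X ^ n + C ((k : ℂ) ^ n) : ℂ[X])).eval z‖ = n := fun z hz => by
    rw [derivative_add, derivative_X_pow, derivative_C, add_zero, eval_mul, eval_C, eval_pow,
      eval_X, norm_mul, norm_pow, hz, one_pow, mul_one, Complex.norm_natCast]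
  obtain ⟨z, hz, h⟩ :=
    exists_norm_eval_eq_maxModulus (derivative (X ^ n + C ((k : ℂ) ^ n) : ℂ[X])) zero_le_one
  rw [← h, he z hz]

/-- Only the first summand survives: `n ≥ 2` makes `a₁` vanish, and all zeros on `|z| = k` make the
minimum vanish. Since `kⁿ|aₙ| = |a₀|`, the factor is exactly `n`. -/
theorem derivLowerBound_X_pow_add_C (hn : 2 ≤ n) (hk : 0 < k) :
    derivLowerBound n k (X ^ n + C ((k : ℂ) ^ n) : ℂ[X]) = n := by
  have h0 : (X ^ n + C ((k : ℂ) ^ n) : ℂ[X]).coeff 0 = (k : ℂ) ^ n := by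
    rw [coeff_add, coeff_X_pow, coeff_C_zero, if_neg (by omega), zero_add]
  have h1 : (X ^ n + C ((k : ℂ) ^ n) : ℂ[X]).coeff 1 = 0 := by
    rw [coeff_add, coeff_X_pow, coeff_C_of_ne_zero one_ne_zero, if_neg (by omega), zero_add]
  have hnn : (X ^ n + C ((k : ℂ) ^ n) : ℂ[X]).coeff n = 1 := by
    rw [coeff_add, coeff_X_pow_self, coeff_C_of_ne_zero (by omega), add_zero]
  have hF : coeffFactor n k (X ^ n + C ((k : ℂ) ^ n) : ℂ[X]) = n := by
    rw [coeffFactor, h0, hnn, norm_one, norm_pow, Complex.norm_real, Real.norm_of_nonneg hk.le,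
      mul_one, sub_self, zero_div, add_zero]
  have hpos : 0 < 1 + k ^ n := by positivity
  rw [derivLowerBound, hF, h1, maxModulus_X_pow_add_C n hk.le,
    minModulus_X_pow_add_C n (by omega) hk.le, norm_zero]
  field_simp
  ring

end Extremal

theorem theorem3 (n : ℕ) (hn : 2 ≤ n) (k : ℝ) (hk : 1 ≤ k) :
    (∀ P : ℂ[X], P.natDegree = n → (∀ z : ℂ, P.eval z = 0 → ‖z‖ ≤ k) →
      derivLowerBound n k P ≤ maxModulus (derivative P) 1) ∧
    ((X ^ n + C ((k : ℂ) ^ n) : ℂ[X]).natDegree = n ∧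
      (∀ z : ℂ, (X ^ n + C ((k : ℂ) ^ n) : ℂ[X]).eval z = 0 → ‖z‖ ≤ k) ∧
      maxModulus (derivative (X ^ n + C ((k : ℂ) ^ n) : ℂ[X])) 1 =
        derivLowerBound n k (X ^ n + C ((k : ℂ) ^ n) : ℂ[X])) := by
  have hk0 : 0 < k := by linarith
  refine ⟨fun P hP hz => derivLowerBound_le_maxModulus hn hk hP hz, natDegree_X_pow_add_C,
    fun z hz => (norm_eq_of_eval_X_pow_add_C_eq_zero n (by omega) hk0.le hz).le, ?_⟩
  rw [maxModulus_derivative_X_pow_add_C, derivLowerBound_X_pow_add_C n hn hk0]
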